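/- Let $M$ be a smooth Riemannian manifold with smooth (possibly empty) boundary $\partial M$; $M$ is Hausdorff and paracompact, but need not be connected, second countable, complete, or of bounded geometry. Let $\partial_D M\subset\partial M$ be an open and closed subset of $\partial M$. All functions and forms are complex valued. Let $H^1(M)$ be the space of all $u\in L^2(M)$ whose distributional differential $du$ belongs to $L^2(M;T^*M)$, with norm $\|u\|_{H^1}^2=\|u\|_{L^2}^2+\|du\|_{L^2}^2$, let $H^1_D(M)=\{u\in H^1(M) : u=0 \text{ on } \partial_D M\}$ (in the sense of traces, taken in $L^2_{\mathrm{loc}}(\partial_D M)$), and let $H^1_D(M)^*$ be the space of bounded conjugate linear functionals on $H^1_D(M)$. For $\lambda\in\mathbb C$ define $\Delta-\lambda\colon H^1_D(M)\to H^1_D(M)^*$ by $$\langle(\Delta-\lambda)u,v\rangle=(du,dv)_{L^2}-\lambda\,(u,v)_{L^2},\qquad u,v\in H^1_D(M),$$ where the scalar products are conjugate linear in the second variable. We say that $(M,\partial_D M)$ satisfies the $L^2$-Poincaré inequality if there is $c>0$ with $\|u\|_{L^2}\le c\,\|du\|_{L^2}$ for all $u\in H^1_D(M)$. Let $c_{M,\partial_D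 M}\in[0,\infty]$ be the infimum of all $c\in[0,\infty)$ for which this inequality holds for all $u \in H^1_D(M)$, with $c_{M,\partial_D M}=\infty$, and hence $(1+c_{M,\partial_D M}^2)^{-1}=0$, if there is no such $c$. Then $\Delta\colon H^1_D(M)\to H^1_D(M)^*$ is an isomorphism (a linear homeomorphism) if and only if $(M,\partial_D M)$ satisfies the $L^2$-Poincaré inequality. Moreover, for every $\lambda\in\mathbb C$ with $\operatorname{Re}\lambda<(1+c_{M,\partial_D M}^2)^{-1}$, the operator $\Delta-\lambda\colon H^1_D(M)\to H^1_D(M)^*$ is strongly coercive, that is, there is $\gamma>0$ with $|\langle(\Delta-\lambda)u,u\rangle|\ge\gamma\|u\|_{H^1}^2$ for all $u\in H^1_D(M)$, and it is an isomorphism. -/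

import Mathlib

open Set MeasureTheory Topology Bundle
open scoped Manifold ContDiff ENNReal NNReal ComplexConjugate

namespace RiemannianLaplacian

/-! ### Pointwise Hermitian product of complex covectors -/

/-- The Hermitian inner product of two complex-valued covectors on a Euclidean space `V`, that is
`∑ conj (α eᵢ) * β eᵢ` for an orthonormal basis `e` (it does not depend on the basis). It is
conjugate linear in the first variable. -/
noncomputable def covInner {V : Type*} [NormedAddCommGroup V] [InnerProductSpace ℝ V]
    [FiniteDimensional ℝ V] (α β : V →L[ℝ] ℂ) : ℂ :=
  ∑ i, conj (α (stdOrthonormalBasis ℝ V i)) * β (stdOrthonormalBasis ℝ V i)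

/-- The complex covector `X♭ + i Y♭`, where `X♭ v = ⟪X, v⟫`. -/
noncomputable def flat {V : Type*} [NormedAddCommGroup V] [InnerProductSpace ℝ V]
    (X Y : V) : V →L[ℝ] ℂ :=
  Complex.ofRealCLM.comp (innerSL ℝ X) + Complex.I • Complex.ofRealCLM.comp (innerSL ℝ Y)

theorem flat_apply {V : Type*} [NormedAddCommGroup V] [InnerProductSpace ℝ V] (X Y v : V) :
    flat X Y v = ((inner ℝ X v : ℝ) : ℂ) + Complex.I * ((inner ℝ Y v : ℝ) : ℂ) := by
  simp [flat]

theorem flat_add {V : Type*} [NormedAddCommGroup V] [InnerProductSpace ℝ V] (X Y X' Y' : V) :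
    flat (X + X') (Y + Y') = flat X Y + flat X' Y' := by
  ext v
  simp only [flat_apply, add_apply, inner_add_left, Complex.ofReal_add]
  ring

theorem flat_smul {V : Type*} [NormedAddCommGroup V] [InnerProductSpace ℝ V] (c : ℂ) (X Y : V) :
    flat (c.re • X - c.im • Y) (c.re • Y + c.im • X) = c • flat X Y := by
  ext v
  simp only [flat_apply, smul_apply, inner_add_left, inner_sub_left,
    real_inner_smul_left, smul_eq_mul]
  apply Complex.ext <;> simp

theorem covInner_flat {V : Type*} [NormedAddCommGroup V] [InnerProductSpace ℝ V]
    [FiniteDimensional ℝ V] (X Y X' Y' : V) :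
    covInner (flat X Y) (flat X' Y') =
      ((inner ℝ X X' + inner ℝ Y Y' : ℝ) : ℂ)
        + Complex.I * ((inner ℝ X Y' - inner ℝ Y X' : ℝ) : ℂ) := by
  have key : ∀ A B : V, ((inner ℝ A B : ℝ) : ℂ) =
      ∑ i, ((inner ℝ A (stdOrthonormalBasis ℝ V i) : ℝ) : ℂ)
        * ((inner ℝ B (stdOrthonormalBasis ℝ V i) : ℝ) : ℂ) := by
    intro A B
    rw [← (stdOrthonormalBasis ℝ V).sum_inner_mul_inner A B]
    push_cast
    refine Finset.sum_congr rfl fun i _ => ?_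
    rw [real_inner_comm B]
  push_cast
  rw [key X X', key Y Y', key X Y', key Y X', ← Finset.sum_add_distrib,
    ← Finset.sum_sub_distrib, Finset.mul_sum, ← Finset.sum_add_distrib]
  refine Finset.sum_congr rfl fun i _ => ?_
  simp only [flat_apply, map_add, map_mul, Complex.conj_ofReal, Complex.conj_I]
  linear_combination (-((inner ℝ Y (stdOrthonormalBasis ℝ V i) : ℝ) : ℂ)
    * ((inner ℝ Y' (stdOrthonormalBasis ℝ V i) : ℝ) : ℂ)) * Complex.I_sq

theorem norm_covInner_le {V : Type*} [NormedAddCommGroup V] [InnerProductSpace ℝ V]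
    [FiniteDimensional ℝ V] (α β : V →L[ℝ] ℂ) :
    ‖covInner α β‖ ≤ ‖covInner α α‖ + ‖covInner β β‖ := by
  have hself : ∀ γ : V →L[ℝ] ℂ, ‖covInner γ γ‖ =
      ∑ i, ‖γ (stdOrthonormalBasis ℝ V i)‖ ^ 2 := by
    intro γ
    have : covInner γ γ = ((∑ i, ‖γ (stdOrthonormalBasis ℝ V i)‖ ^ 2 : ℝ) : ℂ) := by
      simp only [covInner, Complex.conj_mul']
      push_cast
      rfl
    rw [this, Complex.norm_real, Real.norm_of_nonneg (by positivity)]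
  rw [hself, hself, ← Finset.sum_add_distrib]
  refine (norm_sum_le _ _).trans (Finset.sum_le_sum fun i _ => ?_)
  rw [norm_mul, RCLike.norm_conj]
  nlinarith [sq_nonneg (‖α (stdOrthonormalBasis ℝ V i)‖ - ‖β (stdOrthonormalBasis ℝ V i)‖),
    sq_nonneg (‖α (stdOrthonormalBasis ℝ V i)‖), sq_nonneg (‖β (stdOrthonormalBasis ℝ V i)‖)]

theorem covInner_add_left {V : Type*} [NormedAddCommGroup V] [InnerProductSpace ℝ V]
    [FiniteDimensional ℝ V] (α β γ : V →L[ℝ] ℂ) :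
    covInner (α + β) γ = covInner α γ + covInner β γ := by
  simp only [covInner, add_apply, map_add, add_mul, Finset.sum_add_distrib]

theorem covInner_add_right {V : Type*} [NormedAddCommGroup V] [InnerProductSpace ℝ V]
    [FiniteDimensional ℝ V] (α β γ : V →L[ℝ] ℂ) :
    covInner α (β + γ) = covInner α β + covInner α γ := by
  simp only [covInner, add_apply, mul_add, Finset.sum_add_distrib]

theorem covInner_smul_left {V : Type*} [NormedAddCommGroup V] [InnerProductSpace ℝ V]
    [FiniteDimensional ℝ V] (c : ℂ) (α β : V →L[ℝ] ℂ) :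
    covInner (c • α) β = conj c * covInner α β := by
  simp only [covInner, smul_apply, smul_eq_mul, map_mul, Finset.mul_sum, mul_assoc]

theorem covInner_smul_right {V : Type*} [NormedAddCommGroup V] [InnerProductSpace ℝ V]
    [FiniteDimensional ℝ V] (c : ℂ) (α β : V →L[ℝ] ℂ) :
    covInner α (c • β) = c * covInner α β := by
  simp only [covInner, smul_apply, smul_eq_mul, Finset.mul_sum, mul_left_comm]

theorem conj_covInner {V : Type*} [NormedAddCommGroup V] [InnerProductSpace ℝ V]
    [FiniteDimensional ℝ V] (α β : V →L[ℝ] ℂ) : conj (covInner β α) = covInner α β := by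
  simp only [covInner, map_sum, map_mul, Complex.conj_conj, mul_comm]

theorem covInner_self_eq {V : Type*} [NormedAddCommGroup V] [InnerProductSpace ℝ V]
    [FiniteDimensional ℝ V] (α : V →L[ℝ] ℂ) :
    covInner α α = (((covInner α α).re : ℝ) : ℂ) :=
  (Complex.conj_eq_iff_re.1 (conj_covInner α α)).symm

theorem covInner_self_re_nonneg {V : Type*} [NormedAddCommGroup V] [InnerProductSpace ℝ V]
    [FiniteDimensional ℝ V] (α : V →L[ℝ] ℂ) : 0 ≤ (covInner α α).re := by
  have : covInner α α = ((∑ i, ‖α (stdOrthonormalBasis ℝ V i)‖ ^ 2 : ℝ) : ℂ) := by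
    simp only [covInner, Complex.conj_mul']
    push_cast
    rfl
  rw [this, Complex.ofReal_re]
  positivity

/-! ### Manifolds with boundary and the Riemannian volume -/

/-- The model with corners is that of manifolds with (possibly empty) boundary: its image is a
closed half-space `{0 ≤ ℓ}`, or the whole space (`ℓ = 0`). -/
def IsHalfSpaceModel {m : ℕ} {H : Type*} [TopologicalSpace H]
    (I : ModelWithCorners ℝ (EuclideanSpace ℝ (Fin m)) H) : Prop :=
  ∃ ℓ : EuclideanSpace ℝ (Fin m) →L[ℝ] ℝ, range I = {y | 0 ≤ ℓ y}

section Manifold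

variable {m : ℕ} {H : Type*} [TopologicalSpace H]
  (I : ModelWithCorners ℝ (EuclideanSpace ℝ (Fin m)) H)
  (M : Type*) [TopologicalSpace M] [ChartedSpace H M]

/-- A continuous partition of unity subordinate to the domains of the preferred charts. -/
noncomputable def chartPartition [T2Space M] [ParacompactSpace M] : PartitionOfUnity M M univ :=
  Classical.choose (PartitionOfUnity.exists_isSubordinate isClosed_univ
    (fun x : M => (chartAt H x).source) (fun x => (chartAt H x).open_source)
    (fun x _ => mem_iUnion.2 ⟨x, mem_chart_source H x⟩))

variable {M}

/-- The coordinate vector field `∂ᵢ` of the chart at `x₀`, at the point with coordinates `y`. -/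
noncomputable def coordVector [IsManifold I ∞ M] (x₀ : M) (y : EuclideanSpace ℝ (Fin m))
    (i : Fin m) : TangentSpace I ((extChartAt I x₀).symm y) :=
  mfderivWithin 𝓘(ℝ, EuclideanSpace ℝ (Fin m)) I (extChartAt I x₀).symm (range I) y
    (EuclideanSpace.basisFun (Fin m) ℝ i)

theorem isCompact_chart_image {x₀ : M} {K : Set M} (hK : IsCompact K)
    (hKs : K ⊆ (extChartAt I x₀).source) : IsCompact (extChartAt I x₀ '' K) :=
  hK.image_of_continuousOn ((continuousOn_extChartAt x₀).mono hKs)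

theorem aestronglyMeasurable_chart {x₀ : M} {K : Set M} (hK : IsCompact K)
    (hKs : K ⊆ (extChartAt I x₀).source) {φ : M → ℂ} (hφ : Continuous φ)
    (μ : Measure (EuclideanSpace ℝ (Fin m))) :
    AEStronglyMeasurable (fun y => φ ((extChartAt I x₀).symm y))
      (μ.restrict (extChartAt I x₀ '' K)) := by
  have hc := isCompact_chart_image I hK hKs
  refine ContinuousOn.aestronglyMeasurable_of_isCompact ?_ hc hc.measurableSet
  refine hφ.comp_continuousOn ((continuousOn_extChartAt_symm x₀).mono ?_)
  rintro _ ⟨x, hx, rfl⟩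
  exact (extChartAt I x₀).map_source (hKs hx)

variable [RiemannianBundle (fun x : M => TangentSpace I x)]

/-- The density `√ det (gᵢⱼ)` of the Riemannian volume in the chart at `x₀`. -/
noncomputable def volumeDensity [IsManifold I ∞ M] (x₀ : M) (y : EuclideanSpace ℝ (Fin m)) : ℝ :=
  √ (Matrix.gram ℝ (coordVector I x₀ y)).det

variable [MeasurableSpace M]

/-- The Riemannian volume on the domain of the chart at `x₀`: the measure `√ det (gᵢⱼ) dy` on the
image of the chart, transported to `M`. -/
noncomputable def chartVolume [IsManifold I ∞ M] (x₀ : M) : Measure M :=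
  ((volume.restrict (extChartAt I x₀).target).withDensity
    (fun y => ENNReal.ofReal (volumeDensity I x₀ y))).map (extChartAt I x₀).symm

variable (M) in
/-- The Riemannian volume measure `dvol_g`, glued from the local expressions `√ det (gᵢⱼ) dy` by a
partition of unity (the result does not depend on the partition). -/
noncomputable def riemannianVolume [T2Space M] [ParacompactSpace M] [IsManifold I ∞ M] :
    Measure M :=
  Measure.sum fun x₀ : M =>
    (chartVolume I x₀).withDensity (fun x => ENNReal.ofReal (chartPartition (H := H) M x₀ x))

end Manifold

/-! ### Square-integrable one-forms -/

section OneForms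

variable {m : ℕ} {H : Type*} [TopologicalSpace H]
  (I : ModelWithCorners ℝ (EuclideanSpace ℝ (Fin m)) H)
  {M : Type*} [TopologicalSpace M] [ChartedSpace H M] [IsManifold I ∞ M]
  [RiemannianBundle (fun x : M => TangentSpace I x)]

instance finiteDimensional_tangentSpace (x : M) : FiniteDimensional ℝ (TangentSpace I x) :=
  inferInstanceAs (FiniteDimensional ℝ (EuclideanSpace ℝ (Fin m)))

/-- Smooth real vector fields on `M` (up to the boundary). -/
def IsSmoothField (X : (x : M) → TangentSpace I x) : Prop :=
  ContMDiff I I.tangent ∞ (fun x => (⟨x, X x⟩ : TangentBundle I M))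

/-- Smooth complex-valued one-forms on `M`: those that correspond, under the musical isomorphism,
to complex vector fields `X + i Y` with `X` and `Y` smooth. -/
def IsSmoothForm (α : (x : M) → TangentSpace I x →L[ℝ] ℂ) : Prop :=
  ∃ X Y : (x : M) → TangentSpace I x,
    IsSmoothField I X ∧ IsSmoothField I Y ∧ ∀ x, α x = flat (X x) (Y x)

theorem IsSmoothForm.continuous_covInner
    [IsContMDiffRiemannianBundle I ∞ (EuclideanSpace ℝ (Fin m)) (fun x : M => TangentSpace I x)]
    {α β : (x : M) → TangentSpace I x →L[ℝ] ℂ}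
    (hα : IsSmoothForm I α) (hβ : IsSmoothForm I β) :
    Continuous fun x => covInner (α x) (β x) := by
  obtain ⟨X, Y, hX, hY, h⟩ := hα
  obtain ⟨X', Y', hX', hY', h'⟩ := hβ
  have key : ∀ {A B : (x : M) → TangentSpace I x}, IsSmoothField I A → IsSmoothField I B →
      Continuous fun x => (inner ℝ (A x) (B x) : ℝ) := fun hA hB =>
    (ContMDiff.inner_bundle (n := ∞) hA hB).continuous
  have := key hX hX'
  have := key hY hY'
  have := key hX hY'
  have := key hY hX'
  simp only [h, h', covInner_flat]
  fun_prop

theorem isSmoothForm_zero : IsSmoothForm I (0 : (x : M) → TangentSpace I x →L[ℝ] ℂ) := by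
  refine ⟨0, 0, ?_, ?_, fun x => ?_⟩
  · exact contMDiff_zeroSection ℝ (TangentSpace I)
  · exact contMDiff_zeroSection ℝ (TangentSpace I)
  · ext v
    simp [flat_apply]

theorem IsSmoothForm.add {α β : (x : M) → TangentSpace I x →L[ℝ] ℂ}
    (hα : IsSmoothForm I α) (hβ : IsSmoothForm I β) : IsSmoothForm I (α + β) := by
  obtain ⟨X, Y, hX, hY, h⟩ := hα
  obtain ⟨X', Y', hX', hY', h'⟩ := hβ
  refine ⟨X + X', Y + Y', hX.add_section hX', hY.add_section hY', fun x => ?_⟩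
  simp only [Pi.add_apply, h, h', flat_add]

theorem IsSmoothForm.smul (c : ℂ) {α : (x : M) → TangentSpace I x →L[ℝ] ℂ}
    (hα : IsSmoothForm I α) : IsSmoothForm I (c • α) := by
  obtain ⟨X, Y, hX, hY, h⟩ := hα
  refine ⟨c.re • X - c.im • Y, c.re • Y + c.im • X,
    (hX.const_smul_section).sub_section (hY.const_smul_section),
    (hY.const_smul_section).add_section (hX.const_smul_section), fun x => ?_⟩
  simp only [Pi.add_apply, Pi.sub_apply, Pi.smul_apply, h, flat_smul]

variable [T2Space M] [ParacompactSpace M] [MeasurableSpace M] [BorelSpace M]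
  [IsContMDiffRiemannianBundle I ∞ (EuclideanSpace ℝ (Fin m)) (fun x : M => TangentSpace I x)]

theorem integrable_covInner {α β : (x : M) → TangentSpace I x →L[ℝ] ℂ}
    (hα : IsSmoothForm I α) (hβ : IsSmoothForm I β)
    (iα : Integrable (fun x => covInner (α x) (α x)) (riemannianVolume I M))
    (iβ : Integrable (fun x => covInner (β x) (β x)) (riemannianVolume I M)) :
    Integrable (fun x => covInner (α x) (β x)) (riemannianVolume I M) :=
  (iα.norm.add iβ.norm).mono' (hα.continuous_covInner I hβ).aestronglyMeasurable
    (.of_forall fun _ => norm_covInner_le _ _)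

variable (M) in
/-- The complex vector space of smooth one-forms `α` on `M` with `∫ |α|² dvol < ∞`. -/
def smoothL2Submodule : Submodule ℂ ((x : M) → TangentSpace I x →L[ℝ] ℂ) where
  carrier := {α | IsSmoothForm I α ∧
    Integrable (fun x => covInner (α x) (α x)) (riemannianVolume I M)}
  zero_mem' := by
    refine ⟨isSmoothForm_zero I, ?_⟩
    simp [covInner]
  add_mem' := by
    rintro α β ⟨hα, iα⟩ ⟨hβ, iβ⟩
    refine ⟨hα.add I hβ, ?_⟩
    have h1 := integrable_covInner I hα hβ iα iβ
    have h2 := integrable_covInner I hβ hα iβ iα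
    refine (((iα.add h1).add h2).add iβ).congr (.of_forall fun x => ?_)
    simp only [Pi.add_apply, covInner_add_left, covInner_add_right]
    ring
  smul_mem' := by
    rintro c α ⟨hα, iα⟩
    refine ⟨hα.smul I c, ?_⟩
    simp only [Pi.smul_apply, covInner_smul_left, covInner_smul_right]
    exact (iα.const_mul _).const_mul _

variable (M) in
/-- The space of smooth square-integrable complex one-forms on `M`. -/
def SmoothL2Form : Type _ := smoothL2Submodule I M

noncomputable instance : AddCommGroup (SmoothL2Form I M) :=
  inferInstanceAs (AddCommGroup (smoothL2Submodule I M))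

noncomputable instance : Module ℂ (SmoothL2Form I M) :=
  inferInstanceAs (Module ℂ (smoothL2Submodule I M))

variable {I} in
/-- The one-form underlying an element of `SmoothL2Form`. -/
def SmoothL2Form.form (α : SmoothL2Form I M) : (x : M) → TangentSpace I x →L[ℝ] ℂ :=
  Subtype.val (p := fun α => α ∈ smoothL2Submodule I M) α

variable {I} in
theorem SmoothL2Form.isSmoothForm (α : SmoothL2Form I M) : IsSmoothForm I α.form :=
  (Subtype.prop (p := fun α => α ∈ smoothL2Submodule I M) α).1

variable {I} in
theorem SmoothL2Form.integrable (α : SmoothL2Form I M) :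
    Integrable (fun x => covInner (α.form x) (α.form x)) (riemannianVolume I M) :=
  (Subtype.prop (p := fun α => α ∈ smoothL2Submodule I M) α).2

/-- The `L²` scalar product `∫ ⟨α, β⟩ dvol` of one-forms. -/
@[reducible] noncomputable def formCore : PreInnerProductSpace.Core ℂ (SmoothL2Form I M) where
  inner α β := ∫ x, covInner (α.form x) (β.form x) ∂(riemannianVolume I M)
  conj_inner_symm α β := by
    rw [← integral_conj]
    simp only [conj_covInner]
  re_inner_nonneg α := by
    have : ∀ x, covInner (α.form x) (α.form x) = (((covInner (α.form x) (α.form x)).re : ℝ) : ℂ) := fun x =>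
      covInner_self_eq _
    rw [integral_congr_ae (.of_forall this), integral_complex_ofReal]
    simp only [RCLike.re_to_complex, Complex.ofReal_re]
    exact integral_nonneg fun x => covInner_self_re_nonneg _
  add_left α β γ := by
    rw [← integral_add (integrable_covInner I α.isSmoothForm γ.isSmoothForm α.integrable γ.integrable)
      (integrable_covInner I β.isSmoothForm γ.isSmoothForm β.integrable γ.integrable)]
    refine integral_congr_ae (.of_forall fun x => ?_)
    exact covInner_add_left _ _ _
  smul_left α β c := by
    rw [← integral_const_mul]
    refine integral_congr_ae (.of_forall fun x => ?_)
    exact covInner_smul_left _ _ _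

noncomputable instance : SeminormedAddCommGroup (SmoothL2Form I M) :=
  InnerProductSpace.Core.toSeminormedAddCommGroup (c := formCore I)

noncomputable instance : InnerProductSpace ℂ (SmoothL2Form I M) :=
  InnerProductSpace.ofCore (formCore I)

theorem inner_smoothL2Form (α β : SmoothL2Form I M) :
    inner ℂ α β = ∫ x, covInner (α.form x) (β.form x) ∂(riemannianVolume I M) := rfl

variable (M) in
/-- The Hilbert space `L²(M; T*M)` of square-integrable complex one-forms, as the completion of the
smooth square-integrable ones. -/
abbrev L2Form : Type _ := UniformSpace.Completion (SmoothL2Form I M)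

variable (M) in
/-- The Hilbert space `L²(M)` of complex functions. -/
noncomputable abbrev L2Fun : Type _ := Lp ℂ 2 (riemannianVolume I M)

end OneForms

/-! ### Operators from a Hilbert space to its conjugate dual -/

section Dual

variable {V W : Type*} [NormedAddCommGroup V] [InnerProductSpace ℂ V]
  [NormedAddCommGroup W] [InnerProductSpace ℂ W]

/-- For a bounded operator `T : V → W`, the bounded operator `u ↦ (v ↦ (T u, T v))` from `V` to the
space of bounded conjugate linear functionals on `V`; here `(a, b)` denotes the scalar product of
`W` that is linear in the first and conjugate linear in the second variable. -/
noncomputable def pullbackForm (T : V →L[ℂ] W) : V →L[ℂ] (V →L⋆[ℂ] ℂ) :=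
  LinearMap.mkContinuous₂
    (LinearMap.mk₂'ₛₗ (RingHom.id ℂ) (starRingEnd ℂ) (fun u v => inner ℂ (T v) (T u))
      (fun _ _ _ => by simp) (fun _ _ _ => by simp)
      (fun _ _ _ => by simp) (fun _ _ _ => by simp [mul_comm]))
    (‖T‖ * ‖T‖) fun u v => by
      have h1 := T.le_opNorm u
      have h2 := T.le_opNorm v
      calc ‖inner ℂ (T v) (T u)‖ ≤ ‖T v‖ * ‖T u‖ := norm_inner_le_norm _ _
        _ ≤ (‖T‖ * ‖v‖) * (‖T‖ * ‖u‖) := by gcongr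
        _ = ‖T‖ * ‖T‖ * ‖u‖ * ‖v‖ := by ring

theorem pullbackForm_apply (T : V →L[ℂ] W) (u v : V) :
    pullbackForm T u v = inner ℂ (T v) (T u) := rfl

/-- `P : V → V*` is strongly coercive: `|⟨Pu, u⟩| ≥ γ ‖u‖²` for some `γ > 0`. -/
def IsStronglyCoercive (P : V →L[ℂ] (V →L⋆[ℂ] ℂ)) : Prop :=
  ∃ γ : ℝ, 0 < γ ∧ ∀ u : V, γ * ‖u‖ ^ 2 ≤ ‖P u u‖

/-- `P : V → V*` is an isomorphism (a linear homeomorphism). -/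
def IsIsomorphism (P : V →L[ℂ] (V →L⋆[ℂ] ℂ)) : Prop :=
  ∃ e : V ≃L[ℂ] (V →L⋆[ℂ] ℂ), (e : V →L[ℂ] (V →L⋆[ℂ] ℂ)) = P

end Dual

/-! ### The Sobolev space `H¹(M)` -/

section Sobolev

variable {m : ℕ} {H : Type*} [TopologicalSpace H]
  (I : ModelWithCorners ℝ (EuclideanSpace ℝ (Fin m)) H)
  {M : Type*} [TopologicalSpace M] [ChartedSpace H M] [IsManifold I ∞ M]
  [RiemannianBundle (fun x : M => TangentSpace I x)]
  [T2Space M] [ParacompactSpace M] [MeasurableSpace M] [BorelSpace M]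
  [IsContMDiffRiemannianBundle I ∞ (EuclideanSpace ℝ (Fin m)) (fun x : M => TangentSpace I x)]

/-- Test functions: smooth, with compact support in the interior of `M`. -/
def IsTestFunction (φ : M → ℂ) : Prop :=
  ContMDiff I 𝓘(ℝ, ℂ) ∞ φ ∧ ∃ K : Set M, IsCompact K ∧ K ⊆ I.interior M ∧ ∀ x ∉ K, φ x = 0

/-- Test one-forms: smooth, with compact support in the interior of `M`. -/
def IsTestForm (η : SmoothL2Form I M) : Prop :=
  ∃ K : Set M, IsCompact K ∧ K ⊆ I.interior M ∧ ∀ x ∉ K, η.form x = 0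

/-- `h = d* η`, where `d*` is the formal adjoint of the differential `d`:
`∫ ⟨dφ, η⟩ dvol = ∫ φ h̄ dvol` for all test functions `φ`. -/
def IsFormalAdjoint (η : SmoothL2Form I M) (h : L2Fun I M) : Prop :=
  ∀ φ : M → ℂ, IsTestFunction I φ →
    ∫ x, covInner (η.form x) (mfderiv I 𝓘(ℝ, ℂ) φ x) ∂(riemannianVolume I M)
      = ∫ x, φ x * conj (h x) ∂(riemannianVolume I M)

/-- `θ = du` in the sense of distributions: `(θ, η) = (u, d* η)` for all test forms `η`. -/
def IsWeakDifferential (u : L2Fun I M) (θ : L2Form I M) : Prop :=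
  ∀ (η : SmoothL2Form I M) (h : L2Fun I M), IsTestForm I η → IsFormalAdjoint I η h →
    inner ℂ (η : L2Form I M) θ = inner ℂ h u

variable (M) in
/-- The Sobolev space `H¹(M)` of all `u ∈ L²(M)` whose distributional differential `du` is in
`L²(M; T*M)`. An element is recorded as the pair `(u, du)` (`du` is determined by `u`), and the
inner product of `L²(M) ⊕ L²(M; T*M)` gives `‖u‖²_{H¹} = ‖u‖²_{L²} + ‖du‖²_{L²}`. -/
def sobolevH1 : Submodule ℂ (WithLp 2 (L2Fun I M × L2Form I M)) where
  carrier := {w | IsWeakDifferential I w.fst w.snd}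
  zero_mem' := by
    intro η h _ _
    simp
  add_mem' := by
    intro v w hv hw η h h1 h2
    simp only [WithLp.add_fst, WithLp.add_snd, inner_add_right, hv η h h1 h2, hw η h h1 h2]
  smul_mem' := by
    intro c v hv η h h1 h2
    simp only [WithLp.smul_fst, WithLp.smul_snd, inner_smul_right, hv η h h1 h2]

/-- `w` is represented by the function `φ`, which is smooth on `M` up to the boundary. -/
def IsSmoothRep (w : sobolevH1 I M) (φ : M → ℂ) : Prop :=
  ContMDiff I 𝓘(ℝ, ℂ) ∞ φ ∧ w.1.fst =ᵐ[riemannianVolume I M] φ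

/-- The function `g` is the trace of `w ∈ H¹(M)` on the subset `D` of the boundary. The trace is the
extension by continuity, from smooth functions to `H¹(M)`, of the restriction map to
`L²_loc(D)`: on each compact subset `K` of `D` in the domain of a chart, `g` is the `L²(K)`-limit
of the restrictions of smooth functions in `H¹(M)` that converge to `w` in `H¹(M)`.
`L²(K)` is taken with respect to the `(m - 1)`-dimensional measure on the boundary hyperplane of the
chart, which on `K` is equivalent to the Riemannian one with densities bounded above and below. -/
def HasTraceOn (D : Set M) (w : sobolevH1 I M) (g : M → ℂ) : Prop :=
  ∀ (x₀ : M) (K : Set M), IsCompact K → K ⊆ D → K ⊆ (extChartAt I x₀).source →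
    ∀ ε : ℝ, 0 < ε → ∃ (v : sobolevH1 I M) (φ : M → ℂ), IsSmoothRep I v φ ∧ ‖w - v‖ < ε ∧
      eLpNorm (fun y => φ ((extChartAt I x₀).symm y) - g ((extChartAt I x₀).symm y)) 2
        ((Measure.hausdorffMeasure ((m : ℝ) - 1)).restrict (extChartAt I x₀ '' K))
        < ENNReal.ofReal ε

/-- The space `H¹_D(M)` of functions in `H¹(M)` that vanish on the part `D` of the boundary. -/
def sobolevH1D (D : Set M) : Submodule ℂ (sobolevH1 I M) where
  carrier := {w | HasTraceOn I D w 0}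
  zero_mem' := by
    intro x₀ K _ _ _ ε hε
    refine ⟨0, 0, ⟨contMDiff_const, ?_⟩, by simpa using hε, by simpa using hε⟩
    exact Lp.coeFn_zero _ _ _
  add_mem' := by
    intro v w hv hw x₀ K hK hKD hKs ε hε
    obtain ⟨v', φ, ⟨hφ, hvφ⟩, hv1, hv2⟩ := hv x₀ K hK hKD hKs (ε / 2) (half_pos hε)
    obtain ⟨w', ψ, ⟨hψ, hwψ⟩, hw1, hw2⟩ := hw x₀ K hK hKD hKs (ε / 2) (half_pos hε)
    refine ⟨v' + w', φ + ψ, ⟨hφ.add hψ, ?_⟩, ?_, ?_⟩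
    · exact (Lp.coeFn_add _ _).trans (hvφ.add hwψ)
    · have h : v + w - (v' + w') = (v - v') + (w - w') := by abel
      rw [h]
      linarith [norm_add_le (v - v') (w - w')]
    · have m1 := aestronglyMeasurable_chart I hK hKs hφ.continuous
        (Measure.hausdorffMeasure ((m : ℝ) - 1))
      have m2 := aestronglyMeasurable_chart I hK hKs hψ.continuous
        (Measure.hausdorffMeasure ((m : ℝ) - 1))
      simp only [Pi.zero_apply, sub_zero, Pi.add_apply] at hv2 hw2 ⊢
      refine (eLpNorm_add_le m1 m2 (by norm_num)).trans_lt ?_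
      rw [← add_halves ε, ENNReal.ofReal_add (half_pos hε).le (half_pos hε).le]
      exact ENNReal.add_lt_add hv2 hw2
  smul_mem' := by
    intro c w hw x₀ K hK hKD hKs ε hε
    have hc : 0 < ‖c‖ + 1 := by positivity
    obtain ⟨v, φ, ⟨hφ, hvφ⟩, hv1, hv2⟩ := hw x₀ K hK hKD hKs (ε / (‖c‖ + 1)) (div_pos hε hc)
    have hlt : ‖c‖ * (ε / (‖c‖ + 1)) < ε := by
      rw [mul_div_assoc', div_lt_iff₀ hc]
      nlinarith [norm_nonneg c]
    refine ⟨c • v, c • φ, ⟨((contDiff_const_smul (𝕜 := ℝ) (n := ∞) c).contMDiff).comp hφ, ?_⟩, ?_, ?_⟩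
    · exact (Lp.coeFn_smul _ _).trans (hvφ.const_smul c)
    · rw [← smul_sub, norm_smul]
      exact (mul_le_mul_of_nonneg_left hv1.le (norm_nonneg c)).trans_lt hlt
    · simp only [Pi.zero_apply, sub_zero, Pi.smul_apply] at hv2 ⊢
      refine (eLpNorm_const_smul_le (c := c)
        (f := fun y => φ ((extChartAt I x₀).symm y))).trans_lt ?_
      refine (mul_le_mul_right hv2.le _).trans_lt ?_
      rw [← ofReal_norm, ← ENNReal.ofReal_mul (norm_nonneg c)]
      exact (ENNReal.ofReal_lt_ofReal_iff hε).2 hlt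

/-! ### The Laplace operator on `H¹_D(M)` -/

/-- The space `H¹_D(M)` as an inner product space, with the inner product of `H¹(M)`. -/
def H1D (D : Set M) : Type _ := sobolevH1D I D

noncomputable instance (D : Set M) : NormedAddCommGroup (H1D I D) :=
  inferInstanceAs (NormedAddCommGroup (sobolevH1D I D))

noncomputable instance (D : Set M) : InnerProductSpace ℂ (H1D I D) :=
  inferInstanceAs (InnerProductSpace ℂ (sobolevH1D I D))

/-- The inclusion of `H¹_D(M)` in `L²(M)`. -/
noncomputable def toL2 (D : Set M) : H1D I D →L[ℂ] L2Fun I M :=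
  (WithLp.fstL 2 ℂ (L2Fun I M) (L2Form I M)).comp
    ((sobolevH1 I M).subtypeL.comp (sobolevH1D I D).subtypeL)

/-- The differential `d : H¹_D(M) → L²(M; T*M)`. -/
noncomputable def diff (D : Set M) : H1D I D →L[ℂ] L2Form I M :=
  (WithLp.sndL 2 ℂ (L2Fun I M) (L2Form I M)).comp
    ((sobolevH1 I M).subtypeL.comp (sobolevH1D I D).subtypeL)

/-- The space `H¹_D(M)*` of bounded conjugate linear functionals on `H¹_D(M)`. -/
abbrev dualH1D (D : Set M) : Type _ := H1D I D →L⋆[ℂ] ℂ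

/-- The operator `Δ : H¹_D(M) → H¹_D(M)*`, `⟨Δu, v⟩ = (du, dv)`. -/
noncomputable def laplacian (D : Set M) : H1D I D →L[ℂ] dualH1D I D :=
  pullbackForm (diff I D)

/-- The inclusion `H¹_D(M) ⊂ L²(M) ⊂ H¹_D(M)*`, `⟨u, v⟩ = (u, v)`. -/
noncomputable def inclusionDual (D : Set M) : H1D I D →L[ℂ] dualH1D I D :=
  pullbackForm (toL2 I D)

theorem laplacian_apply (D : Set M) (u v : H1D I D) :
    laplacian I D u v = inner ℂ (diff I D v) (diff I D u) := rfl

theorem inclusionDual_apply (D : Set M) (u v : H1D I D) :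
    inclusionDual I D u v = inner ℂ (toL2 I D v) (toL2 I D u) := rfl

/-- `(M, D)` satisfies the `L²`-Poincaré inequality. -/
def SatisfiesPoincare (D : Set M) : Prop :=
  ∃ c : ℝ, 0 < c ∧ ∀ u : H1D I D, ‖toL2 I D u‖ ≤ c * ‖diff I D u‖

/-- The best constant in the `L²`-Poincaré inequality, `∞` if the inequality does not hold. -/
noncomputable def poincareConst (D : Set M) : ℝ≥0∞ :=
  ⨅ (c : ℝ≥0) (_ : ∀ u : H1D I D, ‖toL2 I D u‖ ≤ c * ‖diff I D u‖), (c : ℝ≥0∞)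

end Sobolev

end RiemannianLaplacian

/-!
The operator `Δ - z` is the one attached to the bounded sesquilinear form
`(du, dv) - z (u, v)` on `H¹_D(M)`, so the theorem is a combination of three facts.

* `H¹_D(M)` is a Hilbert space (`completeSpace_H1D`). The defining equations of a weak differential
  are closed conditions, so `H¹(M)` is closed in `L²(M) ⊕ L²(M; T*M)`; and since a vanishing trace
  is expressed through approximation in `H¹(M)` by smooth functions with small boundary values, it
  passes to limits in `H¹(M)`. No trace theorem is needed.
* The complex Lax–Milgram theorem (`IsStronglyCoercive.isIsomorphism`): strong coercivity implies
  that the operator is an isomorphism.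
* Coercivity below the threshold (`isStronglyCoercive_laplacian_sub`). The real part of
  `⟨(Δ - z)u, u⟩` is `‖du‖² - Re z ‖u‖²`. For `Re z < 0` this dominates `‖u‖²_{H¹}`. Otherwise, with
  `c` the Poincaré constant, which is attained (`norm_toL2_le_poincareConst_mul`),
  `‖u‖²_{H¹} ≤ (1 + c²) ‖du‖²`, and the real part is at least
  `((1 + c²)⁻¹ - Re z) ‖u‖²_{H¹}`.

The Poincaré inequality makes the threshold positive, and then `z = 0` shows that `Δ` is an
isomorphism. Conversely, `‖Δu‖ ≤ ‖du‖`, so bounded invertibility of `Δ` gives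
`‖u‖_{L²} ≤ ‖u‖_{H¹} ≤ C ‖Δu‖ ≤ C ‖du‖`.
-/

namespace RiemannianLaplacian

/-! ### The complex Lax–Milgram theorem -/

section LaxMilgram

variable {V : Type*} [NormedAddCommGroup V] [InnerProductSpace ℂ V]

theorem sub_zero_smul (P Q : V →L[ℂ] (V →L⋆[ℂ] ℂ)) : P - (0 : ℂ) • Q = P := by
  refine ContinuousLinearMap.ext fun u => ContinuousLinearMap.ext fun v => ?_
  change P u v - (0 : ℂ) * Q u v = P u v
  ring

theorem IsStronglyCoercive.antilipschitz {P : V →L[ℂ] (V →L⋆[ℂ] ℂ)} (hP : IsStronglyCoercive P) :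
    ∃ K : ℝ≥0, AntilipschitzWith K P := by
  obtain ⟨γ, hγ, h⟩ := hP
  refine ⟨γ⁻¹.toNNReal, P.antilipschitz_of_bound fun u => ?_⟩
  rw [Real.coe_toNNReal _ (inv_pos.2 hγ).le, ← div_eq_inv_mul, le_div_iff₀' hγ]
  rcases (norm_nonneg u).eq_or_lt with h0 | h0
  · simp [← h0]
  · refine le_of_mul_le_mul_right ?_ h0
    calc γ * ‖u‖ * ‖u‖ = γ * ‖u‖ ^ 2 := by ring
      _ ≤ ‖P u u‖ := h u
      _ ≤ ‖P u‖ * ‖u‖ := (P u).le_opNorm u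

variable [CompleteSpace V]

/-- Riesz representation of bounded conjugate linear functionals. -/
theorem exists_eq_inner (f : V →L⋆[ℂ] ℂ) : ∃ w : V, ∀ v, f v = inner ℂ v w := by
  let g : StrongDual ℂ V := LinearMap.mkContinuous
    { toFun := fun v => conj (f v)
      map_add' := fun v w => by simp
      map_smul' := fun c v => by simp } ‖f‖ fun v => by simpa using f.le_opNorm v
  refine ⟨(InnerProductSpace.toDual ℂ V).symm g, fun v => ?_⟩
  rw [← inner_conj_symm, InnerProductSpace.toDual_symm_apply]
  simp [g]

/-- The **Lax–Milgram theorem** for operators from a complex Hilbert space to its conjugate dual. -/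
theorem IsStronglyCoercive.isIsomorphism {P : V →L[ℂ] (V →L⋆[ℂ] ℂ)} (hP : IsStronglyCoercive P) :
    IsIsomorphism P := by
  obtain ⟨K, hK⟩ := hP.antilipschitz
  -- `A` is the operator on `V` with `P u v = (A u, v)`
  let A : V →L[ℂ] V :=
    ContinuousLinearMap.adjoint (InnerProductSpace.continuousLinearMapOfBilin P.flip)
  have hA : ∀ u v, inner ℂ v (A u) = P u v := fun u v => by
    rw [ContinuousLinearMap.adjoint_inner_right,
      InnerProductSpace.continuousLinearMapOfBilin_apply, ContinuousLinearMap.flip_apply]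
  have hPA : ∀ u, ‖P u‖ ≤ ‖A u‖ := fun u =>
    (P u).opNorm_le_bound (norm_nonneg _) fun v => by
      rw [← hA, mul_comm]
      exact norm_inner_le_norm _ _
  have hAK : AntilipschitzWith K A := A.antilipschitz_of_bound fun u => by
    refine (ZeroHomClass.bound_of_antilipschitz P hK u).trans ?_
    gcongr
    exact hPA u
  have : CompleteSpace A.range := (hAK.isClosed_range A.uniformContinuous).completeSpace_coe
  have hsurj : A.range = ⊤ := by
    rw [← A.range.orthogonal_eq_bot_iff, Submodule.eq_bot_iff]
    intro w hw
    obtain ⟨γ, hγ, h⟩ := hP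
    have h0 : P w w = 0 := by
      rw [← hA]
      exact Submodule.inner_left_of_mem_orthogonal (LinearMap.mem_range_self _ w) hw
    have := h w
    rw [h0, norm_zero] at this
    have : ‖w‖ ^ 2 = 0 := le_antisymm (nonpos_of_mul_nonpos_right this hγ) (by positivity)
    simpa using this
  have hPsurj : P.range = ⊤ := by
    rw [LinearMap.range_eq_top]
    intro f
    obtain ⟨w, hw⟩ := exists_eq_inner f
    obtain ⟨u, rfl⟩ : ∃ u, A u = w := LinearMap.range_eq_top.1 hsurj w
    exact ⟨u, ContinuousLinearMap.ext fun v => (hA u v).symm.trans (hw v).symm⟩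
  exact ⟨.ofBijective P (LinearMap.ker_eq_bot.2 hK.injective) hPsurj,
    ContinuousLinearEquiv.coe_ofBijective _ _ _⟩

end LaxMilgram

section Sobolev

variable {m : ℕ} {H : Type*} [TopologicalSpace H]
  (I : ModelWithCorners ℝ (EuclideanSpace ℝ (Fin m)) H)
  {M : Type*} [TopologicalSpace M] [ChartedSpace H M] [IsManifold I ∞ M]
  [RiemannianBundle (fun x : M => TangentSpace I x)]
  [T2Space M] [ParacompactSpace M] [MeasurableSpace M] [BorelSpace M]
  [IsContMDiffRiemannianBundle I ∞ (EuclideanSpace ℝ (Fin m)) (fun x : M => TangentSpace I x)]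

/-! ### Completeness of `H¹_D(M)` -/

variable (M) in
theorem isClosed_sobolevH1 :
    IsClosed (sobolevH1 I M : Set (WithLp 2 (L2Fun I M × L2Form I M))) := by
  have : (sobolevH1 I M : Set (WithLp 2 (L2Fun I M × L2Form I M))) =
      ⋂ (η : SmoothL2Form I M) (h : L2Fun I M) (_ : IsTestForm I η) (_ : IsFormalAdjoint I η h),
        {w | inner ℂ (η : L2Form I M) w.snd = inner ℂ h w.fst} := by
    ext w
    simp only [mem_iInter]
    rfl
  rw [this]
  refine isClosed_iInter fun η => isClosed_iInter fun h => isClosed_iInter fun _ =>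
    isClosed_iInter fun _ => isClosed_eq ?_ ?_
  · exact continuous_const.inner (WithLp.sndL 2 ℂ (L2Fun I M) (L2Form I M)).continuous
  · exact continuous_const.inner (WithLp.fstL 2 ℂ (L2Fun I M) (L2Form I M)).continuous

theorem isClosed_sobolevH1D (D : Set M) :
    IsClosed (sobolevH1D I D : Set (sobolevH1 I M)) := by
  refine isClosed_of_closure_subset fun w hw x₀ K hK hKD hKs ε hε => ?_
  obtain ⟨w', hw', hd⟩ := Metric.mem_closure_iff.1 hw (ε / 2) (half_pos hε)
  obtain ⟨v, φ, hvφ, h1, h2⟩ := hw' x₀ K hK hKD hKs (ε / 2) (half_pos hε)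
  refine ⟨v, φ, hvφ, ?_, h2.trans_le (ENNReal.ofReal_le_ofReal (half_le_self hε.le))⟩
  rw [dist_eq_norm] at hd
  linarith [norm_sub_le_norm_sub_add_norm_sub w w' v]

instance completeSpace_H1D (D : Set M) : CompleteSpace (H1D I D) := by
  have : CompleteSpace (sobolevH1 I M) := (isClosed_sobolevH1 I M).completeSpace_coe
  exact (isClosed_sobolevH1D I D).completeSpace_coe

/-! ### The Poincaré inequality and coercivity -/

theorem norm_sq_H1D {D : Set M} (u : H1D I D) :
    ‖u‖ ^ 2 = ‖toL2 I D u‖ ^ 2 + ‖diff I D u‖ ^ 2 :=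
  WithLp.prod_norm_sq_eq_of_L2 (α := L2Fun I M) (β := L2Form I M) _

theorem norm_toL2_le {D : Set M} (u : H1D I D) : ‖toL2 I D u‖ ≤ ‖u‖ := by
  refine le_of_sq_le_sq ?_ (norm_nonneg u)
  nlinarith [norm_sq_H1D I u, sq_nonneg ‖diff I D u‖]

theorem norm_diff_le {D : Set M} (u : H1D I D) : ‖diff I D u‖ ≤ ‖u‖ := by
  refine le_of_sq_le_sq ?_ (norm_nonneg u)
  nlinarith [norm_sq_H1D I u, sq_nonneg ‖toL2 I D u‖]

theorem norm_laplacian_le {D : Set M} (u : H1D I D) : ‖laplacian I D u‖ ≤ ‖diff I D u‖ :=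
  (laplacian I D u).opNorm_le_bound (norm_nonneg _) fun v => by
    rw [laplacian_apply, mul_comm]
    exact (norm_inner_le_norm _ _).trans (by gcongr; exact norm_diff_le I v)

theorem IsIsomorphism.satisfiesPoincare {D : Set M} (h : IsIsomorphism (laplacian I D)) :
    SatisfiesPoincare I D := by
  obtain ⟨e, he⟩ := h
  have hsymm : ∀ u, e.symm (laplacian I D u) = u := fun u => by
    rw [← he]
    exact e.symm_apply_apply u
  refine ⟨‖(e.symm : dualH1D I D →L[ℂ] H1D I D)‖ + 1, by positivity, fun u => ?_⟩
  calc ‖toL2 I D u‖ ≤ ‖u‖ := norm_toL2_le I u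
    _ = ‖(e.symm : dualH1D I D →L[ℂ] H1D I D) (laplacian I D u)‖ := by
      rw [ContinuousLinearEquiv.coe_coe, hsymm]
    _ ≤ ‖(e.symm : dualH1D I D →L[ℂ] H1D I D)‖ * ‖laplacian I D u‖ :=
      ContinuousLinearMap.le_opNorm _ _
    _ ≤ (‖(e.symm : dualH1D I D →L[ℂ] H1D I D)‖ + 1) * ‖diff I D u‖ := by
      gcongr
      · linarith
      · exact norm_laplacian_le I u

theorem SatisfiesPoincare.poincareConst_ne_top {D : Set M} (h : SatisfiesPoincare I D) :
    poincareConst I D ≠ ⊤ := by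
  obtain ⟨c, hc, h⟩ := h
  refine ne_top_of_le_ne_top (ENNReal.coe_ne_top (r := ⟨c, hc.le⟩)) ?_
  exact iInf₂_le (⟨c, hc.le⟩ : ℝ≥0) h

/-- The infimum defining the Poincaré constant is attained if it is finite. -/
theorem norm_toL2_le_poincareConst_mul {D : Set M} (h : poincareConst I D ≠ ⊤) (u : H1D I D) :
    ‖toL2 I D u‖ ≤ (poincareConst I D).toReal * ‖diff I D u‖ := by
  have key : ∀ b : ℝ, (poincareConst I D).toReal < b → ‖toL2 I D u‖ ≤ b * ‖diff I D u‖ := by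
    intro b hb
    have hlt : poincareConst I D < ENNReal.ofReal b := (ENNReal.lt_ofReal_iff_toReal_lt h).2 hb
    simp only [poincareConst, iInf_lt_iff] at hlt
    obtain ⟨c, hc, hcb⟩ := hlt
    refine (hc u).trans ?_
    gcongr
    exact_mod_cast (ENNReal.lt_ofReal_iff_toReal_lt ENNReal.coe_ne_top).1 hcb |>.le
  have hcont : Filter.Tendsto (fun b : ℝ => b * ‖diff I D u‖)
      (𝓝[>] (poincareConst I D).toReal) (𝓝 ((poincareConst I D).toReal * ‖diff I D u‖)) :=
    ((continuous_id.mul continuous_const).tendsto _).mono_left nhdsWithin_le_nhds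
  exact ge_of_tendsto hcont (eventually_nhdsWithin_of_forall key)

theorem re_laplacian_sub_apply_self {D : Set M} (z : ℂ) (u : H1D I D) :
    ((laplacian I D - z • inclusionDual I D) u u).re =
      ‖diff I D u‖ ^ 2 - z.re * ‖toL2 I D u‖ ^ 2 := by
  have : (laplacian I D - z • inclusionDual I D) u u =
      inner ℂ (diff I D u) (diff I D u) - z * inner ℂ (toL2 I D u) (toL2 I D u) := rfl
  rw [this, inner_self_eq_norm_sq_to_K, inner_self_eq_norm_sq_to_K]
  simp [← Complex.ofReal_pow]

theorem isStronglyCoercive_laplacian_sub {D : Set M} {z : ℂ}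
    (hz : z.re < ((1 + poincareConst I D ^ 2)⁻¹).toReal) :
    IsStronglyCoercive (laplacian I D - z • inclusionDual I D) := by
  suffices ∃ γ : ℝ, 0 < γ ∧ ∀ u : H1D I D,
      γ * ‖u‖ ^ 2 ≤ ‖diff I D u‖ ^ 2 - z.re * ‖toL2 I D u‖ ^ 2 by
    obtain ⟨γ, hγ, h⟩ := this
    refine ⟨γ, hγ, fun u => (h u).trans ?_⟩
    rw [← re_laplacian_sub_apply_self]
    exact Complex.re_le_norm _
  rcases lt_or_ge z.re 0 with h0 | h0
  · refine ⟨min 1 (-z.re), lt_min one_pos (neg_pos.2 h0), fun u => ?_⟩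
    rw [norm_sq_H1D]
    nlinarith [mul_le_mul_of_nonneg_right (min_le_left 1 (-z.re)) (sq_nonneg ‖diff I D u‖),
      mul_le_mul_of_nonneg_right (min_le_right 1 (-z.re)) (sq_nonneg ‖toL2 I D u‖)]
  · have hc : poincareConst I D ≠ ⊤ := by
      intro hc
      simp [hc] at hz
      linarith
    set c := (poincareConst I D).toReal with hcdef
    have hval : ((1 + poincareConst I D ^ 2)⁻¹).toReal = (1 + c ^ 2)⁻¹ := by
      rw [ENNReal.toReal_inv, ENNReal.toReal_add ENNReal.one_ne_top (ENNReal.pow_ne_top hc),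
        ENNReal.toReal_pow, ENNReal.toReal_one]
    rw [hval] at hz
    refine ⟨(1 + c ^ 2)⁻¹ - z.re, sub_pos.2 hz, fun u => ?_⟩
    have hP : ‖toL2 I D u‖ ^ 2 ≤ c ^ 2 * ‖diff I D u‖ ^ 2 := by
      rw [← mul_pow]
      gcongr
      exact norm_toL2_le_poincareConst_mul I hc u
    have hle : (1 + c ^ 2)⁻¹ * ‖u‖ ^ 2 ≤ ‖diff I D u‖ ^ 2 := by
      rw [inv_mul_le_iff₀ (by positivity)]
      linarith [norm_sq_H1D I u]
    have hz' : z.re * ‖toL2 I D u‖ ^ 2 ≤ z.re * ‖u‖ ^ 2 := by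
      gcongr
      exact norm_toL2_le I u
    linarith

end Sobolev

end RiemannianLaplacian

theorem mainTheorem9 {m : ℕ} {H : Type*} [TopologicalSpace H]
    (I : ModelWithCorners ℝ (EuclideanSpace ℝ (Fin m)) H)
    (hI : RiemannianLaplacian.IsHalfSpaceModel I)
    {M : Type*} [TopologicalSpace M] [T2Space M] [ParacompactSpace M]
    [ChartedSpace H M] [IsManifold I ∞ M]
    [MeasurableSpace M] [BorelSpace M]
    [RiemannianBundle (fun x : M => TangentSpace I x)]
    [IsContMDiffRiemannianBundle I ∞ (EuclideanSpace ℝ (Fin m)) (fun x : M => TangentSpace I x)]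
    (D : Set M) (hD : D ⊆ I.boundary M)
    (hDclopen : IsClopen ((↑) ⁻¹' D : Set (I.boundary M))) :
    (RiemannianLaplacian.IsIsomorphism (RiemannianLaplacian.laplacian I D) ↔
      RiemannianLaplacian.SatisfiesPoincare I D) ∧
    ∀ z : ℂ, z.re < ((1 + RiemannianLaplacian.poincareConst I D ^ 2)⁻¹).toReal →
      RiemannianLaplacian.IsStronglyCoercive (RiemannianLaplacian.laplacian I D
        - z • RiemannianLaplacian.inclusionDual I D) ∧
      RiemannianLaplacian.IsIsomorphism (RiemannianLaplacian.laplacian I D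
        - z • RiemannianLaplacian.inclusionDual I D) := by
  open RiemannianLaplacian in
  have main : ∀ z : ℂ, z.re < ((1 + poincareConst I D ^ 2)⁻¹).toReal →
      IsStronglyCoercive (laplacian I D - z • inclusionDual I D) ∧
      IsIsomorphism (laplacian I D - z • inclusionDual I D) := fun z hz =>
    have h := isStronglyCoercive_laplacian_sub I hz
    ⟨h, h.isIsomorphism⟩
  refine ⟨⟨fun h => h.satisfiesPoincare I, fun h => ?_⟩, main⟩
  have hpos : (0 : ℂ).re < ((1 + RiemannianLaplacian.poincareConst I D ^ 2)⁻¹).toReal := by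
    rw [Complex.zero_re, ENNReal.toReal_pos_iff]
    have hc := h.poincareConst_ne_top
    exact ⟨by simp [hc, ENNReal.pow_eq_top_iff], by simp [ENNReal.inv_lt_top]⟩
  exact RiemannianLaplacian.sub_zero_smul (RiemannianLaplacian.laplacian I D)
    (RiemannianLaplacian.inclusionDual I D) ▸ (main 0 hpos).2
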